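/- Graphs are simple and undirected, of arbitrary (finite or infinite) cardinality; the size of a finite graph is its number of edges, and a vertex of odd (even) degree is one whose degree is finite and odd (even). Let the edges of a graph be colored. A vertex $v$ is \emph{majority colored} if there is no color $\alpha$ such that the cardinality of the set of edges at $v$ of color $\alpha$ is larger than that of the set of the remaining edges at $v$. A vertex $v$ is \emph{almost majority colored} if it is not majority colored and there is a color $\alpha$ such that $v$ is incident with more edges of color $\alpha$ than of all other colors together, but with at most two more. A \emph{majority edge-coloring} is an edge-coloring in which every vertex is majority colored. A \emph{list assignment of size $2$} gives each edge $e$ a set $L(e)$ of exactly two colors, and a coloring $c$ is \emph{from the lists} if $c(e)\in L(e)$ for every edge $e$. \textbf{Theorem.} Let $G$ be a connected graph of arbitrary cardinality. (1) $G$ has a majority edge-coloring from every list assignment of size $2$ if and only if no vertex of $G$ has odd degree and $G$ is not a finite graph of odd size. (2) For every list assignment of size $2$ there is an edge-coloring of $G$ from the lists in which every vertex that is not of odd degree is majority colored and every vertex of odd degree is majority colored or almost majority colored, or else $G$ is a finite graph of odd size with all vertices of even degree. (3) $G$ has a majority edge-coloring with the two colors $0,1$ if and only if no vertex of $G$ has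 odd degree and $G$ is not a finite graph of odd size. For a graph $G$ that need not be connected, (1), (2) and (3) hold with the condition on finiteness and size imposed on the connected components: in (1) and (3), "$G$ is not a finite graph of odd size" is replaced by "no connected component of $G$ is a finite graph of odd size", and in (2), the exceptional case is that some connected component of $G$ is a finite graph of odd size with all vertices of even degree. -/

import Mathlib

universe u w

namespace MajorityEdgeColoring

/-- The cardinality of the set of edges incident to `v` that have color `α`. -/
def incidentOfColor {V : Type u} {G : SimpleGraph V} {C : Type w}
    (c : G.edgeSet → C) (v : V) (α : C) : Cardinal.{u} :=
  Cardinal.mk {e : G.edgeSet // v ∈ (e : Sym2 V) ∧ c e = α}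

/-- The cardinality of the set of edges incident to `v` whose color is different from `α`. -/
def incidentOfOtherColor {V : Type u} {G : SimpleGraph V} {C : Type w}
    (c : G.edgeSet → C) (v : V) (α : C) : Cardinal.{u} :=
  Cardinal.mk {e : G.edgeSet // v ∈ (e : Sym2 V) ∧ c e ≠ α}

/-- `v` is majority colored: no color occurs on more edges at `v` than all other colors together. -/
def IsMajorityColored {V : Type u} {G : SimpleGraph V} {C : Type w}
    (c : G.edgeSet → C) (v : V) : Prop :=
  ¬ ∃ α : C, incidentOfOtherColor c v α < incidentOfColor c v α

/-- `v` is almost majority colored: it is not majority colored, and there is an overwhelming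
color, i.e. one that occurs on more edges at `v` than all the other colors together, but on at most
two more. -/
def IsAlmostMajorityColored {V : Type u} {G : SimpleGraph V} {C : Type w}
    (c : G.edgeSet → C) (v : V) : Prop :=
  ¬ IsMajorityColored c v ∧
    ∃ α : C, incidentOfOtherColor c v α < incidentOfColor c v α ∧
      incidentOfColor c v α ≤ incidentOfOtherColor c v α + 2

/-- A majority edge-coloring: every vertex is majority colored. -/
def IsMajorityEdgeColoring {V : Type u} {G : SimpleGraph V} {C : Type w}
    (c : G.edgeSet → C) : Prop :=
  ∀ v : V, IsMajorityColored c v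

/-- `G` has a majority edge-coloring with the colors `0, …, k - 1`. -/
def HasMajorityEdgeColoring {V : Type u} (G : SimpleGraph V) (k : ℕ) : Prop :=
  ∃ c : G.edgeSet → Fin k, IsMajorityEdgeColoring c

/-- `G` has a majority edge-coloring from every assignment of lists of size `k` to its edges. -/
def HasMajorityListEdgeColorings {V : Type u} (G : SimpleGraph V) (k : ℕ) : Prop :=
  ∀ (C : Type w) (L : G.edgeSet → Finset C), (∀ e, (L e).card = k) →
    ∃ c : G.edgeSet → C, (∀ e, c e ∈ L e) ∧ IsMajorityEdgeColoring c

/-- The degree of `v` is finite and odd. -/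
def HasOddDegree {V : Type u} (G : SimpleGraph V) (v : V) : Prop :=
  (G.neighborSet v).Finite ∧ Odd (G.neighborSet v).ncard

/-- The degree of `v` is finite and even. -/
def HasEvenDegree {V : Type u} (G : SimpleGraph V) (v : V) : Prop :=
  (G.neighborSet v).Finite ∧ Even (G.neighborSet v).ncard

/-- `G` is a finite graph of odd size (the size is the number of edges). -/
def IsFiniteOfOddSize {V : Type u} (G : SimpleGraph V) : Prop :=
  Finite V ∧ Odd G.edgeSet.ncard

/-- Every vertex that is not of odd degree (so, of even or infinite degree) is majority colored, and
every vertex of odd degree is majority colored or almost majority colored. -/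
def IsGoodEdgeColoring {V : Type u} {G : SimpleGraph V} {C : Type w}
    (c : G.edgeSet → C) : Prop :=
  (∀ v : V, ¬ HasOddDegree G v → IsMajorityColored c v) ∧
    ∀ v : V, HasOddDegree G v → IsMajorityColored c v ∨ IsAlmostMajorityColored c v

end MajorityEdgeColoring

namespace MajorityEdgeColoring
open SimpleGraph

/-! ### Euler trails in finite components -/

section Trails

variable {V : Type u} {G : SimpleGraph V}

/-! Necessity: with two colors, a majority colored vertex of finite degree has equally many edges of
both colors, so no degree is odd. In a finite component the subgraph of color 0 has half of every
degree, so the handshake lemma makes the size even.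

Sufficiency is all in `exists_isGoodEdgeColoring`, by coloring along Euler trails so that
consecutive edges differ: each visit to a vertex then pairs two edges of different colors.

In a finite component with even degrees only the closing of the trail is critical. If all lists
agree, two colors alternate, and even size makes them close up; if not, an edge with a different
list gives the freedom needed (`exists_balanced_of_even_component`).

Outside these components a coloring balanced up to one is enough at vertices of finite degree, since
parity removes the excess when the degree is even. A vertex of infinite degree is split into nodes
of degree 3; balance up to one there says that no triple is monochromatic, and then no color can win
(`exists_coloring_off_finite_even`). The resulting incidence system is locally finite, and by
compactness finite subsystems suffice (`exists_nearly_balanced`). Those are joined to an apex that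
makes all degrees even; the Euler trail starts and ends at the apex, where nothing is required, so a
greedy coloring never has to close up (`exists_nearly_balanced_of_finite`). -/

theorem finite_edges_of_finite_reachable {r : V} (hfin : {v | G.Reachable r v}.Finite) :
    {e : Sym2 V | e ∈ G.edgeSet ∧ ∀ x ∈ e, G.Reachable r x}.Finite := by
  refine ((hfin.prod hfin).image fun q => s(q.1, q.2)).subset ?_
  rintro e ⟨-, h⟩
  induction e using Sym2.ind with
  | _ x y => exact ⟨(x, y), ⟨h x (by simp), h y (by simp)⟩, rfl⟩

theorem reachable_of_mem_edges {u v : V} {p : G.Walk u v} {e : Sym2 V} (he : e ∈ p.edges) :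
    ∀ x ∈ e, G.Reachable u x := by
  classical
  intro x hx
  exact ⟨p.takeUntil x (p.mem_support_of_mem_edges he hx)⟩

/-- A trail ending at a vertex of even degree that is not its start can be prolonged. -/
theorem exists_unused_edge_of_ne {u v : V} {p : G.Walk u v} (hp : p.IsTrail) (huv : u ≠ v)
    (hv : HasEvenDegree G v) : ∃ w, G.Adj v w ∧ s(v, w) ∉ p.edges := by
  classical
  by_contra! hcon
  -- An open trail uses an odd number of edges at its last vertex, but if no edge at `v` were unused
  -- this number would be the degree.
  have hodd := (hp.even_countP_edges_iff v).not.mpr (by simp [huv])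
  apply hodd
  have : p.edges.countP (fun e => v ∈ e) = (G.neighborSet v).ncard := by
    rw [List.countP_eq_length_filter, ← List.toFinset_card_of_nodup (hp.edges_nodup.filter _),
      ← Set.ncard_coe_finset, ← Set.ncard_image_of_injective (f := fun w => s(v, w))]
    · congr 1
      ext e
      simp only [List.coe_toFinset, List.mem_filter, decide_eq_true_eq, Set.mem_ofPred_eq,
        Set.mem_image, mem_neighborSet]
      constructor
      · rintro ⟨he, hve⟩
        obtain ⟨w, rfl⟩ := hve
        exact ⟨w, p.edges_subset_edgeSet he, rfl⟩
      · rintro ⟨w, hw, rfl⟩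
        exact ⟨hcon w hw, by simp⟩
    · intro a b hab
      exact Sym2.congr_right.mp hab
  rw [this]
  exact hv.2

/-- **Euler's theorem**: a finite component all of whose vertices have even degree has a closed
trail through all its edges. -/
theorem exists_closed_trail_covering (r : V) (hfin : {v | G.Reachable r v}.Finite)
    (heven : ∀ v, G.Reachable r v → HasEvenDegree G v) :
    ∃ p : G.Walk r r, p.IsTrail ∧ ∀ x y, G.Adj x y → G.Reachable r x → s(x, y) ∈ p.edges := by
  classical
  let A : Set ℕ := {n | ∃ (u v : V) (p : G.Walk u v), G.Reachable r u ∧ p.IsTrail ∧ p.length = n}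
  have hF := finite_edges_of_finite_reachable hfin
  have hA : BddAbove A := by
    refine ⟨hF.toFinset.card, ?_⟩
    rintro n ⟨u, v, p, hu, hp, rfl⟩
    rw [← Walk.length_edges, ← List.toFinset_card_of_nodup hp.edges_nodup]
    refine Finset.card_le_card fun e he => ?_
    rw [List.mem_toFinset] at he
    rw [Set.Finite.mem_toFinset]
    exact ⟨p.edges_subset_edgeSet he, fun x hx => hu.trans (reachable_of_mem_edges he x hx)⟩
  -- A longest trail. It is closed, because it cannot be prolonged at its end.
  obtain ⟨u, v, p, hu, hp, hlen⟩ :=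
    Nat.sSup_mem (s := A) ⟨0, r, r, Walk.nil, Reachable.refl r, by simp, rfl⟩ hA
  have hmax : ∀ (u' v' : V) (q : G.Walk u' v'), G.Reachable r u' → q.IsTrail →
      q.length ≤ p.length := fun u' v' q hu' hq => by
    rw [hlen]; exact le_csSup hA ⟨u', v', q, hu', hq, rfl⟩
  have huv : u = v := by
    by_contra huv
    obtain ⟨w, hw, hwp⟩ := exists_unused_edge_of_ne hp huv (heven v (hu.trans ⟨p⟩))
    have := hmax u w (p.concat hw) hu (by
      rw [Walk.isTrail_def, Walk.edges_concat, List.concat_eq_append]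
      exact (List.nodup_append_comm.mp (by simpa using ⟨hwp, hp.edges_nodup⟩)))
    simp at this
  subst huv
  -- A closed trail can be rotated to start at `z`, where an unused edge could be prepended.
  have hused : ∀ z ∈ p.support, ∀ y, G.Adj z y → s(z, y) ∈ p.edges := by
    intro z hz y hzy
    by_contra hno
    have := hmax y z (Walk.cons hzy.symm (p.rotate z hz))
      ((hu.trans ⟨p.takeUntil z hz⟩).trans hzy.reachable) (by
        rw [Walk.isTrail_cons]
        refine ⟨(p.isTrail_rotate hz).mpr hp, ?_⟩
        rw [(p.rotate_edges z hz).mem_iff, Sym2.eq_swap]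
        exact hno)
    simp at this
  have hsupp : ∀ x, G.Reachable u x → x ∈ p.support := by
    rintro x ⟨q⟩
    have : ∀ {a b : V} (q : G.Walk a b), a ∈ p.support → b ∈ p.support := by
      intro a b q
      induction q with
      | nil => exact id
      | cons h _ ih =>
        exact fun ha => ih (p.snd_mem_support_of_mem_edges (hused _ ha _ h))
    exact this q p.start_mem_support
  refine ⟨p.rotate r (hsupp r hu.symm), (p.isTrail_rotate _).mpr hp, fun x y hxy hx => ?_⟩
  rw [(p.rotate_edges r _).mem_iff]
  exact hused x (hsupp x (hu.symm.trans hx)) y hxy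

end Trails

/-! ### Colorings along a trail -/

section ChainColored

variable {V : Type u} {C : Type w} {G : SimpleGraph V}

/-- Consecutive edges along the walk have colors that are related at their common vertex, where the
first edge is preceded by a virtual edge of color `a` and the last one is followed by a virtual edge
of color `b`. -/
def ChainColored (R : V → C → C → Prop) (c : Sym2 V → C) :
    {u v : V} → G.Walk u v → C → C → Prop
  | u, _, .nil, a, b => R u a b
  | u, _, .cons (v := v) _ p, a, b => R u a (c s(u, v)) ∧ ChainColored R c p (c s(u, v)) b

theorem ChainColored.congr {R : V → C → C → Prop} {c c' : Sym2 V → C} {u v : V} {p : G.Walk u v}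
    {a b : C} (h : ChainColored R c p a b) (hc : ∀ e ∈ p.edges, c e = c' e) :
    ChainColored R c' p a b := by
  induction p generalizing a with
  | nil => exact h
  | cons hadj p ih =>
    simp only [Walk.edges_cons, List.mem_cons, forall_eq_or_imp] at hc
    obtain ⟨h1, h2⟩ := h
    rw [hc.1] at h1 h2
    exact ⟨h1, ih h2 hc.2⟩

open Classical in
/-- Along a chain-colored walk, the contributions at a vertex `x` come in pairs. -/
theorem ChainColored.sum_mem {M : Type*} [AddCommMonoid M] (P : AddSubmonoid M) (g : C → M)
    {R : V → C → C → Prop} {c : Sym2 V → C} {x : V}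
    (hR : ∀ a b, R x a b → g a + g b ∈ P) {u v : V} {p : G.Walk u v} {a b : C}
    (h : ChainColored R c p a b) :
    (if x = u then g a else 0) + (p.edges.map fun e => if x ∈ e then g (c e) else 0).sum +
      (if x = v then g b else 0) ∈ P := by
  induction p generalizing a with
  | nil =>
    split_ifs with hx
    · subst hx; simpa using hR _ _ h
    · simp
  | @cons u y v hadj p ih =>
    obtain ⟨h1, h2⟩ := h
    have := ih h2
    simp only [Walk.edges_cons, List.map_cons, List.sum_cons, Sym2.mem_iff]
    -- If `x` is left here, `a` and the color of the first edge form a pair, and `x ≠ y` prevents a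
    -- second count. If `x` is entered here, the first edge supplies the start term of the remaining
    -- walk.
    by_cases hxu : x = u
    · subst hxu
      simp only [hadj.ne, if_false, zero_add] at this
      simp only [true_or, if_true, ← add_assoc]
      rw [add_assoc (g a + g _)]
      exact P.add_mem (hR _ _ h1) this
    · simpa only [hxu, false_or, if_false, zero_add] using this

/-- Greedy coloring of the edges of a trail. -/
theorem exists_chainColored {R : V → C → C → Prop} (ok : V → C → Prop)
    (hstep : ∀ x y a, G.Adj x y → ok x a → ∃ b, R x a b ∧ ok x b ∧ ok y b) {u v : V}
    {p : G.Walk u v} (hp : p.IsTrail) {a : C} (ha : ok u a) (hend : ∀ a, ∃ b, R v a b) :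
    ∃ (c : Sym2 V → C) (b : C), ChainColored R c p a b ∧ ∀ e ∈ p.edges, ∀ x ∈ e, ok x (c e) := by
  classical
  induction p generalizing a with
  | nil =>
    obtain ⟨b, hb⟩ := hend a
    exact ⟨fun _ => a, b, hb, by simp⟩
  | @cons u y v hadj p ih =>
    rw [Walk.isTrail_cons] at hp
    obtain ⟨a', h1, h2, h3⟩ := hstep u y a hadj ha
    obtain ⟨c, b, hc, hok⟩ := ih hp.1 h3 hend
    have hcongr : ∀ e ∈ p.edges, c e = Function.update c s(u, y) a' e := fun e he =>
      (Function.update_of_ne (by rintro rfl; exact hp.2 he) _ _).symm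
    refine ⟨Function.update c s(u, y) a', b, ⟨?_, ?_⟩, ?_⟩
    · simpa using h1
    · simpa using hc.congr hcongr
    · simp only [Walk.edges_cons, List.mem_cons, forall_eq_or_imp]
      refine ⟨by simp [h2, h3], fun e he => ?_⟩
      rw [← hcongr e he]
      exact hok e he

/-- Prepend an edge with a prescribed color. -/
theorem ChainColored.cons_update [DecidableEq V] {R : V → C → C → Prop} {c : Sym2 V → C}
    {L : Sym2 V → Finset C} {u y v : V}
    {hadj : G.Adj u y} {p : G.Walk y v} (hp : s(u, y) ∉ p.edges) {a a' b : C} (h1 : R u a a')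
    (ha' : a' ∈ L s(u, y)) (h : ChainColored R c p a' b) (hL : ∀ e ∈ p.edges, c e ∈ L e) :
    ChainColored R (Function.update c s(u, y) a') (Walk.cons hadj p) a b ∧
      ∀ e ∈ (Walk.cons hadj p).edges, Function.update c s(u, y) a' e ∈ L e := by
  have hcongr : ∀ e ∈ p.edges, c e = Function.update c s(u, y) a' e := fun e he =>
    (Function.update_of_ne (by rintro rfl; exact hp he) _ _).symm
  refine ⟨⟨?_, ?_⟩, ?_⟩
  · simpa using h1
  · simpa using h.congr hcongr
  · simp only [Walk.edges_cons, List.mem_cons, forall_eq_or_imp]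
    refine ⟨by simpa using ha', fun e he => ?_⟩
    rw [← hcongr e he]
    exact hL e he

/-- Being able to start with either of two colors, one reaches every end color. -/
theorem exists_chainColored_of_two {L : Sym2 V → Finset C} {u v : V} {p : G.Walk u v}
    (hL : ∀ e ∈ p.edges, (L e).card = 2) (hp : p.IsTrail) {A : Finset C} (hA : A.card = 2) (b : C) :
    ∃ a ∈ A, ∃ c : Sym2 V → C, ChainColored (fun _ => (· ≠ ·)) c p a b ∧ ∀ e ∈ p.edges, c e ∈ L e := by
  classical
  induction p generalizing A with
  | nil =>
    obtain ⟨a, ha, hab⟩ := Finset.exists_mem_ne (by omega : 1 < A.card) b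
    exact ⟨a, ha, fun _ => a, hab, by simp⟩
  | @cons u y v hadj p ih =>
    rw [Walk.isTrail_cons] at hp
    simp only [Walk.edges_cons, List.mem_cons, forall_eq_or_imp] at hL
    -- The choice runs backwards from `b`: at each edge, one of two colors avoids the color already
    -- chosen behind it.
    obtain ⟨a', ha', c, hc, hcL⟩ := ih hL.2 hp.1 hL.1
    obtain ⟨a, ha, haa'⟩ := Finset.exists_mem_ne (by omega : 1 < A.card) a'
    exact ⟨a, ha, _, ChainColored.cons_update hp.2 haa' ha' hc hcL⟩

/-- If the lists along a trail do not all agree with `A`, then from some color of `A` one reaches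
every end color. -/
theorem exists_chainColored_of_ne {L : Sym2 V → Finset C} {u v : V} {p : G.Walk u v}
    (hL : ∀ e ∈ p.edges, (L e).card = 2) (hp : p.IsTrail) {A : Finset C} (hA : A.card = 2)
    (hne : ∃ e ∈ p.edges, L e ≠ A) :
    ∃ a ∈ A, ∀ b, ∃ c : Sym2 V → C,
      ChainColored (fun _ => (· ≠ ·)) c p a b ∧ ∀ e ∈ p.edges, c e ∈ L e := by
  classical
  induction p generalizing A with
  | nil => simp at hne
  | @cons u y v hadj p ih =>
    rw [Walk.isTrail_cons] at hp
    simp only [Walk.edges_cons, List.mem_cons, forall_eq_or_imp] at hL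
    by_cases h : L s(u, y) = A
    · obtain ⟨a', ha', hall⟩ := ih hL.2 hp.1 hL.1 (by
        simp only [Walk.edges_cons, List.mem_cons, exists_eq_or_imp] at hne
        rcases hne with hne | hne
        · exact absurd h hne
        · rwa [h])
      obtain ⟨a, ha, haa'⟩ := Finset.exists_mem_ne (by omega : 1 < A.card) a'
      refine ⟨a, ha, fun b => ?_⟩
      obtain ⟨c, hc, hcL⟩ := hall b
      exact ⟨_, ChainColored.cons_update hp.2 haa' ha' hc hcL⟩
    -- A color outside the first list forbids nothing on the first edge, so both of its colors
    -- remain available for every `b`.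
    · obtain ⟨a, ha, haL⟩ : ∃ a ∈ A, a ∉ L s(u, y) := by
        by_contra! hsub
        exact h (Finset.eq_of_subset_of_card_le hsub (by omega)).symm
      refine ⟨a, ha, fun b => ?_⟩
      obtain ⟨a', ha', c, hc, hcL⟩ := exists_chainColored_of_two hL.2 hp.1 hL.1 b
      exact ⟨_, ChainColored.cons_update hp.2 (by rintro rfl; exact haL ha') ha' hc hcL⟩

/-- Two colors alternate along a trail. -/
theorem exists_chainColored_alternating {u v : V} {p : G.Walk u v} (hp : p.IsTrail) {a b : C}
    (hab : a ≠ b) :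
    ∃ c : Sym2 V → C, ChainColored (fun _ => (· ≠ ·)) c p a (if Odd p.length then a else b) ∧
      ∀ e ∈ p.edges, c e = a ∨ c e = b := by
  classical
  induction p generalizing a b with
  | nil => exact ⟨fun _ => a, by simpa [ChainColored] using hab, by simp⟩
  | @cons u y v hadj p ih =>
    rw [Walk.isTrail_cons] at hp
    obtain ⟨c, hc, hcL⟩ := ih hp.1 hab.symm
    have := ChainColored.cons_update (L := fun _ => {a, b}) (hadj := hadj) hp.2 hab (by simp) hc
      (fun e he => by simpa [or_comm] using hcL e he)
    refine ⟨_, ?_, fun e he => by simpa using this.2 e he⟩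
    convert this.1 using 1
    simp only [Walk.length_cons, Nat.odd_add_one]
    split_ifs <;> simp_all

open Classical in
/-- The sum over the edges of a trail that contain `x` is a sum over the neighbors of `x`. -/
theorem sum_edges_eq_sum_neighbors {M : Type*} [AddCommMonoid M] {u v x : V} {p : G.Walk u v}
    (hp : p.IsTrail) (hx : ∀ y, G.Adj x y → s(x, y) ∈ p.edges) (N : Finset V)
    (hN : ∀ y, y ∈ N ↔ G.Adj x y) (f : Sym2 V → M) :
    (p.edges.map fun e => if x ∈ e then f e else 0).sum = ∑ y ∈ N, f s(x, y) := by
  rw [← List.sum_toFinset _ hp.edges_nodup, ← Finset.sum_filter]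
  refine (Finset.sum_bij (fun y _ => s(x, y)) ?_ ?_ ?_ ?_).symm
  · intro y hy
    simp [hx y ((hN y).mp hy)]
  · intro y _ z _ h
    exact Sym2.congr_right.mp h
  · intro e he
    simp only [Finset.mem_filter, List.mem_toFinset] at he
    obtain ⟨he, y, rfl⟩ := he
    exact ⟨y, (hN y).mpr (p.edges_subset_edgeSet he), rfl⟩
  · intros; rfl

end ChainColored

/-! ### Finite components with all degrees even -/

/-- A component in which all degrees are even can be majority colored, unless it is of odd size. -/
theorem exists_balanced_of_even_component {V : Type u} {C : Type w} [Nonempty C] {G : SimpleGraph V} (r : V)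
    (hfin : {v | G.Reachable r v}.Finite) (heven : ∀ v, G.Reachable r v → HasEvenDegree G v)
    (hsize : Even {e : Sym2 V | e ∈ G.edgeSet ∧ ∀ x ∈ e, G.Reachable r x}.ncard)
    (L : Sym2 V → Finset C) (hL : ∀ e ∈ G.edgeSet, (L e).card = 2) :
    ∃ c : Sym2 V → C,
      (∀ e ∈ G.edgeSet, (∀ x ∈ e, G.Reachable r x) → c e ∈ L e) ∧
      ∀ v, G.Reachable r v → ∀ γ : C, {y | G.Adj v y ∧ c s(v, y) = γ}.ncard ≤
        {y | G.Adj v y ∧ c s(v, y) ≠ γ}.ncard := by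
  classical
  obtain ⟨p, hp, hcov⟩ := exists_closed_trail_covering r hfin heven
  have hpL : ∀ e ∈ p.edges, (L e).card = 2 := fun e he => hL e (p.edges_subset_edgeSet he)
  have hcov' : ∀ e ∈ G.edgeSet, (∀ x ∈ e, G.Reachable r x) → e ∈ p.edges := by
    intro e
    induction e using Sym2.ind with
    | _ x y => exact fun h hr => hcov x y h (hr x (by simp))
  have hlen : Even p.length := by
    rw [← Walk.length_edges, ← List.toFinset_card_of_nodup hp.edges_nodup, ← Set.ncard_coe_finset]
    convert hsize using 2
    ext e
    simp only [List.coe_toFinset, Set.mem_ofPred_eq]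
    exact ⟨fun he => ⟨p.edges_subset_edgeSet he, reachable_of_mem_edges he⟩,
      fun he => hcov' e he.1 he.2⟩
  -- With weight -1 for `γ` and 1 for every other color, a pair of different colors has nonnegative
  -- weight.
  obtain ⟨c, hcL, hsum⟩ : ∃ c : Sym2 V → C, (∀ e ∈ p.edges, c e ∈ L e) ∧
      ∀ (γ : C) (x : V), 0 ≤ (p.edges.map fun e =>
        if x ∈ e then (if c e = γ then (-1 : ℤ) else 1) else 0).sum := by
    cases p with
    | nil =>
      exact ⟨fun _ => Classical.arbitrary C, by simp, by simp⟩
    | @cons _ y _ hadj p =>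
      rw [Walk.isTrail_cons] at hp
      simp only [Walk.edges_cons, List.mem_cons, forall_eq_or_imp] at hpL
      -- The first edge of the closed trail plays the virtual edge at both ends of the rest, so its
      -- color `a` has to be the start and the end color.
      obtain ⟨a, ha, c, hc, hcL⟩ : ∃ a ∈ L s(r, y), ∃ c : Sym2 V → C,
          ChainColored (fun _ => (· ≠ ·)) c p a a ∧ ∀ e ∈ p.edges, c e ∈ L e := by
        by_cases hne : ∃ e ∈ p.edges, L e ≠ L s(r, y)
        · obtain ⟨a, ha, h⟩ := exists_chainColored_of_ne hpL.2 hp.1 hpL.1 hne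
          exact ⟨a, ha, h a⟩
        · push Not at hne
          obtain ⟨a, b, hab, hLab⟩ := Finset.card_eq_two.mp hpL.1
          obtain ⟨c, hc, hcab⟩ := exists_chainColored_alternating hp.1 hab
          -- The only use of even size: the rest of the trail has odd length, so the alternation
          -- ends with `a`.
          rw [if_pos (by simpa [Nat.even_add_one] using hlen)] at hc
          refine ⟨a, by simp [hLab], c, hc, fun e he => ?_⟩
          rw [hne e he, hLab]
          simpa using hcab e he
      have hcongr : ∀ e ∈ p.edges, c e = Function.update c s(r, y) a e := fun e he =>
        (Function.update_of_ne (by rintro rfl; exact hp.2 he) _ _).symm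
      refine ⟨Function.update c s(r, y) a, ?_, fun γ x => ?_⟩
      · simp only [Walk.edges_cons, List.mem_cons, forall_eq_or_imp]
        refine ⟨by simpa using ha, fun e he => ?_⟩
        rw [← hcongr e he]
        exact hcL e he
      · have := (hc.congr hcongr).sum_mem (AddSubmonoid.nonneg ℤ)
          (fun a => if a = γ then (-1 : ℤ) else 1) (x := x) (by
            intro a b hab
            rw [AddSubmonoid.mem_nonneg]
            split_ifs <;> simp_all)
        rw [AddSubmonoid.mem_nonneg] at this
        refine this.trans_eq ?_
        simp only [Walk.edges_cons, List.map_cons, List.sum_cons, Sym2.mem_iff,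
          Function.update_self]
        have := hadj.ne
        by_cases h1 : x = r <;> by_cases h2 : x = y <;> simp_all; ring
  refine ⟨c, fun e he hr => hcL e (hcov' e he hr), fun v hv γ => ?_⟩
  obtain ⟨hNfin, -⟩ := heven v hv
  have h0 := hsum γ v
  rw [sum_edges_eq_sum_neighbors hp (fun y hy => hcov v y hy hv) hNfin.toFinset (by simp)
    (fun e => if c e = γ then (-1 : ℤ) else 1), Finset.sum_ite] at h0
  have e1 : {y | G.Adj v y ∧ c s(v, y) = γ}
      = ((hNfin.toFinset.filter fun y => c s(v, y) = γ : Finset V) : Set V) := by ext; simp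
  have e2 : {y | G.Adj v y ∧ c s(v, y) ≠ γ}
      = ((hNfin.toFinset.filter fun y => ¬ c s(v, y) = γ : Finset V) : Set V) := by ext; simp
  rw [e1, e2, Set.ncard_coe_finset, Set.ncard_coe_finset]
  simp at h0
  omega

/-! ### Finite incidence systems and the apex -/

section IncidenceSystem

variable {S E : Type*} {C : Type w} (I : S → E → Prop)

/-- The graph on the nodes `S`, the edges `E` and an additional vertex, the apex, of an incidence
system: nodes are joined to their edges, and the apex to the nodes of odd degree and to the edges
with just one end. -/
def apexGraph : SimpleGraph (S ⊕ Option E) where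
  Adj
    | .inl w, .inr (some e) => I w e
    | .inr (some e), .inl w => I w e
    | .inl w, .inr none => Odd {e | I w e}.ncard
    | .inr none, .inl w => Odd {e | I w e}.ncard
    | .inr (some e), .inr none => {w | I w e}.ncard = 1
    | .inr none, .inr (some e) => {w | I w e}.ncard = 1
    | _, _ => False
  symm := ⟨by rintro (w | _ | e) (w' | _ | e') h <;> exact h⟩
  loopless := ⟨by rintro (w | _ | e) h <;> exact h⟩

variable {I}

section Adj

variable {w w' : S} {e e' : E}

theorem apexGraph_adj_node_node : (apexGraph I).Adj (.inl w) (.inl w') ↔ False := Iff.rfl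

theorem apexGraph_adj_node_edge : (apexGraph I).Adj (.inl w) (.inr (some e)) ↔ I w e := Iff.rfl

theorem apexGraph_adj_edge_node : (apexGraph I).Adj (.inr (some e)) (.inl w) ↔ I w e := Iff.rfl

theorem apexGraph_adj_node_apex :
    (apexGraph I).Adj (.inl w) (.inr none) ↔ Odd {e | I w e}.ncard := Iff.rfl

theorem apexGraph_adj_edge_apex :
    (apexGraph I).Adj (.inr (some e)) (.inr none) ↔ {w | I w e}.ncard = 1 := Iff.rfl

theorem apexGraph_adj_edge_edge :
    (apexGraph I).Adj (.inr (some e)) (.inr (some e')) ↔ False := Iff.rfl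

end Adj

open Classical in
theorem ncard_eq_sum_ite {X : Type*} [Fintype X] (p : X → Prop) :
    {x | p x}.ncard = ∑ x, if p x then 1 else 0 := by
  rw [Finset.sum_boole, ← Set.ncard_coe_finset]
  simp

/-- The edges to the apex correct the parity at the nodes and at the edges with one end; the apex
itself follows from the handshake lemma. -/
theorem apexGraph_hasEvenDegree [Finite S] [Finite E]
    (h2 : ∀ e, {w | I w e}.ncard = 1 ∨ {w | I w e}.ncard = 2) (x : S ⊕ Option E) :
    HasEvenDegree (apexGraph I) x := by
  classical
  have := Fintype.ofFinite S
  have := Fintype.ofFinite E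
  have hrest : ∀ x ≠ .inr none, Even ((apexGraph I).neighborSet x).ncard := by
    rintro (w | _ | e) hx
    · change Even {y | (apexGraph I).Adj (.inl w) y}.ncard
      rw [ncard_eq_sum_ite, Fintype.sum_sum_type, Fintype.sum_option]
      simp only [apexGraph_adj_node_node, apexGraph_adj_node_edge,
      apexGraph_adj_node_apex, if_false, Finset.sum_const_zero, zero_add]
      rw [← ncard_eq_sum_ite]
      split_ifs with h
      · exact odd_one.add_odd h
      · simpa using h
    · exact absurd rfl hx
    · change Even {y | (apexGraph I).Adj (.inr (some e)) y}.ncard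
      rw [ncard_eq_sum_ite, Fintype.sum_sum_type, Fintype.sum_option]
      simp only [apexGraph_adj_edge_node, apexGraph_adj_edge_apex,
      apexGraph_adj_edge_edge, if_false, Finset.sum_const_zero, add_zero]
      rw [← ncard_eq_sum_ite]
      rcases h2 e with h | h <;> simp [h]
  refine ⟨Set.toFinite _, ?_⟩
  by_cases hx : x = .inr none
  · subst hx
    by_contra hodd
    have hdeg : ∀ y, (apexGraph I).degree y = ((apexGraph I).neighborSet y).ncard := fun y => by
      rw [← card_neighborSet_eq_degree, Set.ncard_eq_toFinset_card', Set.toFinset_card]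
    have := (apexGraph I).even_card_odd_degree_vertices
    rw [show (Finset.univ.filter fun y => Odd ((apexGraph I).degree y)) = {.inr none} by
      ext y
      simp only [Finset.mem_filter, Finset.mem_univ, true_and, Finset.mem_singleton, hdeg]
      constructor
      · intro hy
        by_contra hne
        exact Nat.not_even_iff_odd.mpr hy (hrest y hne)
      · rintro rfl
        exact Nat.not_even_iff_odd.mp hodd] at this
    simp at this
  · exact hrest x hx

/-- The nodes not reachable from the apex form a closed set, and `hconn` provides a link from any
nonempty closed set to the apex. -/
theorem apexGraph_reachable [Finite S]
    (h2 : ∀ e, {w | I w e}.ncard = 1 ∨ {w | I w e}.ncard = 2)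
    (hconn : ∀ A : Set S, A.Nonempty → (∀ w ∈ A, ∀ w' e, I w e → I w' e → w' ∈ A) →
      ∃ w ∈ A, Odd {e | I w e}.ncard ∨ ∃ e, I w e ∧ {w | I w e}.ncard = 1)
    (x : S ⊕ Option E) : (apexGraph I).Reachable (.inr none) x := by
  have hS : ∀ w : S, (apexGraph I).Reachable (.inr none) (.inl w) := by
    by_contra! hcon
    obtain ⟨w, hw, h⟩ := hconn {w | ¬ (apexGraph I).Reachable (.inr none) (.inl w)} hcon
      (fun w hw w' e hwe hwe' hr => hw <| by
        have h1 : (apexGraph I).Adj (.inl w') (.inr (some e)) := hwe'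
        have h2 : (apexGraph I).Adj (.inr (some e)) (.inl w) := hwe
        exact (hr.trans h1.reachable).trans h2.reachable)
    apply hw
    rcases h with h | ⟨e, he, h⟩
    · have h1 : (apexGraph I).Adj (.inr none) (.inl w) := h
      exact h1.reachable
    · have h1 : (apexGraph I).Adj (.inr none) (.inr (some e)) := h
      have h2 : (apexGraph I).Adj (.inr (some e)) (.inl w) := he
      exact h1.reachable.trans h2.reachable
  rcases x with w | _ | e
  · exact hS w
  · exact Reachable.refl _
  · obtain ⟨w, hw⟩ : {w | I w e}.Nonempty := by
      rw [← Set.ncard_pos]; rcases h2 e with h | h <;> omega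
    have h1 : (apexGraph I).Adj (.inl w) (.inr (some e)) := hw
    exact (hS w).trans h1.reachable

/-- A finite incidence system, each of whose components has a node of odd degree or an edge with
only one end, has a coloring from lists of size two that is balanced up to one at every node. -/
theorem exists_nearly_balanced_of_finite [Finite S] [Finite E] [Nonempty C]
    (h2 : ∀ e, {w | I w e}.ncard = 1 ∨ {w | I w e}.ncard = 2)
    (hconn : ∀ A : Set S, A.Nonempty → (∀ w ∈ A, ∀ w' e, I w e → I w' e → w' ∈ A) →
      ∃ w ∈ A, Odd {e | I w e}.ncard ∨ ∃ e, I w e ∧ {w | I w e}.ncard = 1)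
    (L : E → Finset C) (hL : ∀ e, (L e).card = 2) :
    ∃ c : E → C, (∀ e, c e ∈ L e) ∧
      ∀ w γ, {e | I w e ∧ c e = γ}.ncard ≤ {e | I w e ∧ c e ≠ γ}.ncard + 1 := by
  classical
  have := Fintype.ofFinite S
  have := Fintype.ofFinite E
  have hreach := apexGraph_reachable h2 hconn
  obtain ⟨p, hp, hcov⟩ := exists_closed_trail_covering (G := apexGraph I) (.inr none)
    (Set.toFinite _) (fun v _ => apexGraph_hasEvenDegree h2 v)
  replace hcov : ∀ x y, (apexGraph I).Adj x y → s(x, y) ∈ p.edges := fun x y h =>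
    hcov x y h (hreach x)
  -- Colors change at nodes, are kept at edges, so that both halves of an edge agree, and are free
  -- at the apex.
  let R : S ⊕ Option E → C → C → Prop
    | .inl _, a, b => a ≠ b
    | .inr (some _), a, b => a = b
    | .inr none, _, _ => True
  let ok : S ⊕ Option E → C → Prop
    | .inr (some e), a => a ∈ L e
    | _, _ => True
  obtain ⟨c, b, hc, hcok⟩ := exists_chainColored (R := R) ok (by
    rintro (w | _ | e) (w' | _ | e') a hadj ha
    · exact hadj.elim
    -- The list of `e` merely supplies some color other than `a`; edges to the apex from a node have
    -- no list.
    · obtain ⟨e, -⟩ : {e | I w e}.Nonempty := by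
        rw [← Set.ncard_pos]; exact Odd.pos hadj
      obtain ⟨b, -, hb⟩ := Finset.exists_mem_ne (by simp [hL e] : 1 < (L e).card) a
      exact ⟨b, hb.symm, trivial, trivial⟩
    · obtain ⟨b, hbL, hb⟩ := Finset.exists_mem_ne (by simp [hL e'] : 1 < (L e').card) a
      exact ⟨b, hb.symm, trivial, hbL⟩
    · exact ⟨Classical.arbitrary C, trivial, trivial, trivial⟩
    · exact hadj.elim
    · obtain ⟨b, hbL⟩ := Finset.card_pos.mp (by simp [hL e'] : 0 < (L e').card)
      exact ⟨b, trivial, trivial, hbL⟩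
    · exact ⟨a, rfl, ha, trivial⟩
    · exact ⟨a, rfl, ha, trivial⟩
    · exact hadj.elim) hp (a := Classical.arbitrary C) trivial
      (fun a => ⟨a, trivial⟩)
  have hend : ∀ e, ∃ w, I w e := fun e => by
    have : {w | I w e}.Nonempty := by
      rw [← Set.ncard_pos]; rcases h2 e with h | h <;> omega
    exact this
  choose ω hω using hend
  have hsame : ∀ e w, I w e → c s(.inl w, .inr (some e)) = c s(.inl (ω e), .inr (some e)) := by
    intro e w hw
    by_contra hne
    set γ := c s(.inl (ω e), .inr (some e)) with hγ
    -- Equal colors in each pair make the number of half-edges of color `γ` at `e` even, whereas two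
    -- different halves would give exactly one.
    have hsum := hc.sum_mem (AddSubmonoid.closure {2}) (fun a => if a = γ then 1 else 0)
      (x := .inr (some e)) (by
        rintro a b (rfl : a = b)
        split_ifs
        · exact AddSubmonoid.subset_closure (by simp)
        · exact AddSubmonoid.zero_mem _)
    simp only [reduceCtorEq, if_false, zero_add, add_zero, Sum.inr.injEq] at hsum
    rw [sum_edges_eq_sum_neighbors hp (fun y hy => hcov _ y hy)
      (Finset.univ.filter fun y => (apexGraph I).Adj (.inr (some e)) y) (by simp)
      (fun k => if c k = γ then 1 else 0), Finset.sum_filter, Fintype.sum_sum_type,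
      Fintype.sum_option] at hsum
    have hcard : {w | I w e} = {ω e, w} := by
      have hsub : ({ω e, w} : Set S) ⊆ {w | I w e} := by
        rintro _ (rfl | rfl)
        · exact hω e
        · exact hw
      refine (Set.eq_of_subset_of_ncard_le hsub ?_).symm
      rw [Set.ncard_pair (by rintro rfl; exact hne rfl)]
      rcases h2 e with h | h <;> omega
    have hfree : ¬ {w | I w e}.ncard = 1 := by
      rw [hcard, Set.ncard_pair (by rintro rfl; exact hne rfl)]; omega
    have hI : ∀ w', I w' e ↔ w' = ω e ∨ w' = w := fun w' => by
      change w' ∈ {w | I w e} ↔ _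
      rw [hcard]; rfl
    simp only [apexGraph_adj_edge_node, apexGraph_adj_edge_apex,
      apexGraph_adj_edge_edge, if_false, Finset.sum_const_zero, add_zero, hfree] at hsum
    simp only [hI] at hsum
    rw [← Finset.sum_filter, show Finset.univ.filter (fun w' => w' = ω e ∨ w' = w) = {ω e, w} by
      ext; simp, Finset.sum_pair (by rintro rfl; exact hne rfl), Sym2.eq_swap, if_pos hγ.symm,
      Sym2.eq_swap, if_neg hne, AddSubmonoid.mem_closure_singleton] at hsum
    obtain ⟨n, hn⟩ := hsum
    rw [smul_eq_mul] at hn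
    omega
  refine ⟨fun e => c s(.inl (ω e), .inr (some e)), fun e => ?_, fun w γ => ?_⟩
  · exact hcok _ (hcov _ _ (apexGraph_adj_node_edge.mpr (hω e))) (.inr (some e)) (by simp)
  · have hsum := hc.sum_mem (AddSubmonoid.nonneg ℤ) (fun a => if a = γ then (-1 : ℤ) else 1)
      (x := .inl w) (by
        rintro a b (hab : a ≠ b)
        rw [AddSubmonoid.mem_nonneg]
        split_ifs <;> simp_all)
    simp only [reduceCtorEq, if_false, zero_add, add_zero, AddSubmonoid.mem_nonneg] at hsum
    rw [sum_edges_eq_sum_neighbors hp (fun y hy => hcov _ y hy)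
      (Finset.univ.filter fun y => (apexGraph I).Adj (.inl w) y) (by simp)
      (fun k => if c k = γ then (-1 : ℤ) else 1), Finset.sum_filter, Fintype.sum_sum_type,
      Fintype.sum_option] at hsum
    simp only [apexGraph_adj_node_node, apexGraph_adj_node_edge,
      apexGraph_adj_node_apex, if_false, Finset.sum_const_zero, zero_add] at hsum
    -- The auxiliary edge to the apex accounts for the possible excess of one.
    have hle : (if Odd {e | I w e}.ncard then
        (if c s(.inl w, .inr none) = γ then (-1 : ℤ) else 1) else 0) ≤ 1 := by
      split_ifs <;> simp
    have heq : (∑ e, if I w e then (if c s(.inl w, .inr (some e)) = γ then (-1 : ℤ) else 1) else 0)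
        = ({e | I w e ∧ c s(.inl (ω e), .inr (some e)) ≠ γ}.ncard : ℤ) -
          {e | I w e ∧ c s(.inl (ω e), .inr (some e)) = γ}.ncard := by
      rw [ncard_eq_sum_ite, ncard_eq_sum_ite]
      push_cast
      rw [← Finset.sum_sub_distrib]
      refine Finset.sum_congr rfl fun e _ => ?_
      by_cases hwe : I w e
      · rw [hsame e w hwe]
        split_ifs <;> simp_all
      · simp [hwe]
    rw [heq] at hsum
    beta_reduce
    omega

end IncidenceSystem

/-! ### Compactness for locally finite incidence systems -/

theorem ncard_subtype {X : Type*} (q p : X → Prop) :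
    {x : {x // q x} | p x}.ncard = {x | q x ∧ p x}.ncard := by
  rw [← Set.ncard_image_of_injective _ Subtype.val_injective]
  congr 1
  ext x
  simp [and_comm]

/-- A locally finite incidence system, in which each edge has at most two ends and which has no
finite closed subsystem of even degrees, has a coloring from lists of size two that is balanced up to
one at every node. -/
theorem exists_nearly_balanced {W E : Type*} {C : Type w} [Nonempty C] (I : W → E → Prop)
    (hfin : ∀ w, {e | I w e}.Finite) (h2 : ∀ e, {w | I w e}.Finite ∧ {w | I w e}.ncard ≤ 2)
    (hconn : ∀ A : Set W, A.Finite → A.Nonempty → (∀ w ∈ A, ∃ e, I w e) →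
      (∀ w ∈ A, Even {e | I w e}.ncard) →
      ¬ ∀ w ∈ A, ∀ e, I w e → {w' | I w' e}.ncard = 2 ∧ ∀ w', I w' e → w' ∈ A)
    (L : E → Finset C) (hL : ∀ e, (L e).card = 2) :
    ∃ c : E → C, (∀ e, c e ∈ L e) ∧
      ∀ w γ, {e | I w e ∧ c e = γ}.ncard ≤ {e | I w e ∧ c e ≠ γ}.ncard + 1 := by
  classical
  have key : ∀ t : Finset E, ∃ g : (e : E) → L e, ∀ w, (∃ e, I w e) → (∀ e, I w e → e ∈ t) →
      ∀ γ, {e | I w e ∧ (g e : C) = γ}.ncard ≤ {e | I w e ∧ (g e : C) ≠ γ}.ncard + 1 := by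
    intro t
    -- Nodes are kept only with all their edges, so degrees do not change, while an edge may lose an
    -- end. Isolated nodes are dropped to keep the subsystem finite.
    let q : W → Prop := fun w => (∃ e, I w e) ∧ ∀ e, I w e → e ∈ t
    let r : E → Prop := fun e => ∃ w, q w ∧ I w e
    have hq : {w | q w}.Finite := by
      refine (t.finite_toSet.biUnion fun e _ => (h2 e).1).subset ?_
      rintro w ⟨⟨e, he⟩, ht⟩
      exact Set.mem_biUnion (ht e he) he
    have : Finite {w // q w} := hq
    have hr : {e | r e}.Finite := t.finite_toSet.subset (by
      rintro e ⟨w, hw, hwe⟩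
      exact hw.2 e hwe)
    have : Finite {e // r e} := hr
    have hsub : ∀ e, {w | q w ∧ I w e} ⊆ {w | I w e} := fun e w hw => hw.2
    have hle : ∀ e, {w | q w ∧ I w e}.ncard ≤ 2 := fun e =>
      (Set.ncard_le_ncard (hsub e) (h2 e).1).trans (h2 e).2
    have hdeg : ∀ w, q w → {e | r e ∧ I w e} = {e | I w e} := fun w hw => by
      ext e
      exact ⟨fun h => h.2, fun h => ⟨⟨w, hw, h⟩, h⟩⟩
    obtain ⟨c, hcL, hc⟩ := exists_nearly_balanced_of_finite (C := C)
      (I := fun (w : {w // q w}) (e : {e // r e}) => I w e) (by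
        rintro ⟨e, w, hw, hwe⟩
        have h0 : 0 < {w | q w ∧ I w e}.ncard := by
          rw [Set.ncard_pos ((h2 e).1.subset (hsub e))]
          exact ⟨w, hw, hwe⟩
        have := hle e
        rw [ncard_subtype q fun w => I w e]
        omega) (by
        -- If `A` has no link to the apex, every edge at `A` has two kept ends, hence all its ends;
        -- then `A` is closed in the whole system, against `hconn`.
        intro A hA hcl
        by_contra! hcon
        refine hconn (Subtype.val '' A) (Set.toFinite _) (hA.image _) ?_ ?_ ?_
        · rintro _ ⟨w, -, rfl⟩
          exact w.2.1
        · rintro _ ⟨w, hw, rfl⟩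
          have := (hcon w hw).1
          rw [ncard_subtype r fun e => I w e, hdeg w w.2] at this
          simpa using this
        · rintro _ ⟨w, hw, rfl⟩ e he
          have h1 := (hcon w hw).2 ⟨e, w, w.2, he⟩ he
          rw [ncard_subtype q fun w => I w e] at h1
          have h0 : 0 < {w | q w ∧ I w e}.ncard := by
            rw [Set.ncard_pos ((h2 e).1.subset (hsub e))]
            exact ⟨w, w.2, he⟩
          have h3 := hle e
          have heq := Set.eq_of_subset_of_ncard_le (hsub e) (by have := (h2 e).2; omega) (h2 e).1
          refine ⟨by rw [← heq]; omega, fun w' hw' => ?_⟩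
          have hqw' : w' ∈ {w | q w ∧ I w e} := by rw [heq]; exact hw'
          exact ⟨⟨w', hqw'.1⟩, hcl w hw ⟨w', hqw'.1⟩ ⟨e, w, w.2, he⟩ he hw', rfl⟩)
      (fun e => L e) (fun e => hL e)
    have hne : ∀ e, ∃ a, a ∈ L e := fun e => Finset.card_pos.mp (by simp [hL e])
    let g : (e : E) → L e := fun e =>
      if h : r e then ⟨c ⟨e, h⟩, hcL ⟨e, h⟩⟩ else ⟨(hne e).choose, (hne e).choose_spec⟩
    have hg : ∀ e : {e // r e}, (g e : C) = c e := fun e => by simp [g, e.2]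
    refine ⟨g, fun w hw1 hw2 γ => ?_⟩
    have hw : q w := ⟨hw1, hw2⟩
    have := hc ⟨w, hw⟩ γ
    simp only [← hg] at this
    rw [ncard_subtype r fun e => I w e ∧ (g e : C) = γ,
      ncard_subtype r fun e => I w e ∧ (g e : C) ≠ γ] at this
    have hr' : ∀ e, I w e → r e := fun e he => ⟨w, hw, he⟩
    convert this using 3
    · ext e; exact ⟨fun h => ⟨hr' e h.1, h⟩, fun h => h.2⟩
    · congr 1; ext e; exact ⟨fun h => ⟨hr' e h.1, h⟩, fun h => h.2⟩
  choose g hg using key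
  -- Rado's selection lemma: on the finitely many edges at a node, `χ` agrees with some `g t` where
  -- `t` contains them all.
  obtain ⟨χ, hχ⟩ := Finset.rado_selection g
  refine ⟨fun e => χ e, fun e => (χ e).2, fun w γ => ?_⟩
  by_cases hw : ∃ e, I w e
  · obtain ⟨t, hst, ht⟩ := hχ (hfin w).toFinset
    have := hg t w hw (fun e he => hst (by simpa using he)) γ
    convert this using 3
    · ext e
      exact and_congr_right fun he => by beta_reduce; rw [ht e (by simpa using he)]
    · congr 1
      ext e
      exact and_congr_right fun he => by beta_reduce; rw [ht e (by simpa using he)]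
  · have : {e | I w e ∧ (χ e : C) = γ} = ∅ := by
      ext e
      simp only [Set.mem_ofPred_eq, Set.mem_empty_iff_false, iff_false]
      exact fun h => hw ⟨e, h.1⟩
    rw [this]
    simp

/-! ### Splitting the vertices of infinite degree -/

section Graphs

variable {V : Type u} {G : SimpleGraph V}

theorem ncard_incident (v : V) (P : Sym2 V → Prop) :
    {e : G.edgeSet | v ∈ (e : Sym2 V) ∧ P e}.ncard = {y | G.Adj v y ∧ P s(v, y)}.ncard := by
  rw [ncard_subtype (fun e => e ∈ G.edgeSet) fun e => v ∈ e ∧ P e,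
    ← Set.ncard_image_of_injective {y | G.Adj v y ∧ P s(v, y)} (f := fun y => s(v, y))
      (fun a b h => Sym2.congr_right.mp h)]
  congr 1
  ext e
  constructor
  · rintro ⟨he, ⟨y, rfl⟩, hP⟩
    exact ⟨y, ⟨he, hP⟩, rfl⟩
  · rintro ⟨y, ⟨he, hP⟩, rfl⟩
    exact ⟨he, by simp, hP⟩

theorem ncard_incident_eq_degree (v : V) :
    {e : G.edgeSet | v ∈ (e : Sym2 V)}.ncard = (G.neighborSet v).ncard := by
  have := ncard_incident (G := G) v fun _ => True
  simp only [and_true] at this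
  exact this

theorem finite_incident_iff (v : V) :
    {e : G.edgeSet | v ∈ (e : Sym2 V)}.Finite ↔ (G.neighborSet v).Finite := by
  rw [← Set.finite_image_iff Subtype.val_injective.injOn,
    ← Set.finite_image_iff (s := G.neighborSet v) (f := fun y => s(v, y))
      (fun a _ b _ h => Sym2.congr_right.mp h)]
  apply iff_of_eq
  congr 1
  ext e
  constructor
  · rintro ⟨e, ⟨y, hy⟩, rfl⟩
    refine ⟨y, ?_, hy.symm⟩
    have := e.2
    rwa [hy] at this
  · rintro ⟨y, he, rfl⟩
    exact ⟨⟨s(v, y), he⟩, by simp, rfl⟩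

/-- At a vertex of infinite degree the edges can be labeled by themselves so that every label is
used three times. -/
theorem exists_labeling (v : V) : ∃ t : G.edgeSet → Option G.edgeSet,
    ((G.neighborSet v).Finite → ∀ e, t e = none) ∧
    (¬ (G.neighborSet v).Finite →
      (∀ x : G.edgeSet, v ∈ (x : Sym2 V) →
        {e : G.edgeSet | v ∈ (e : Sym2 V) ∧ t e = some x}.ncard = 3) ∧
      ∀ e : G.edgeSet, v ∈ (e : Sym2 V) → ∃ x : G.edgeSet, v ∈ (x : Sym2 V) ∧ t e = some x) := by
  classical
  by_cases hfin : (G.neighborSet v).Finite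
  · exact ⟨fun _ => none, fun _ _ => rfl, fun h => absurd hfin h⟩
  · let X := {e : G.edgeSet // v ∈ (e : Sym2 V)}
    have hX : Infinite X := Set.infinite_coe_iff.mpr ((finite_incident_iff v).not.mpr hfin)
    -- An infinite set is equinumerous with three copies of itself; the label of an edge is its
    -- first coordinate.
    have hmk : Cardinal.mk X = Cardinal.mk (X × Fin 3) := by
      rw [Cardinal.mk_prod, Cardinal.lift_uzero, Cardinal.mk_fin, Cardinal.lift_natCast,
        Cardinal.mul_eq_left (Cardinal.aleph0_le_mk X)
          ((Cardinal.natCast_lt_aleph0).le.trans (Cardinal.aleph0_le_mk X)) (by norm_num)]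
    obtain ⟨φ⟩ := Cardinal.eq.mp hmk
    refine ⟨fun e => if h : v ∈ (e : Sym2 V) then some (φ ⟨e, h⟩).1.1 else none,
      fun h => absurd h hfin, fun _ => ⟨fun x hx => ?_, fun e he => ?_⟩⟩
    · have hinj : Function.Injective fun i : Fin 3 => (φ.symm (⟨x, hx⟩, i)).1 := fun i j hij => by
        simpa using Subtype.val_injective hij
      have h3 : (Set.range fun i : Fin 3 => (φ.symm (⟨x, hx⟩, i)).1).ncard = 3 := by
        rw [← Set.image_univ, Set.ncard_image_of_injective _ hinj, Set.ncard_univ]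
        simp
      refine Eq.trans (congrArg Set.ncard ?_) h3
      ext e
      constructor
      · rintro ⟨he, hex⟩
        simp only [dif_pos he, Option.some_inj] at hex
        refine ⟨(φ ⟨e, he⟩).2, ?_⟩
        have : (⟨x, hx⟩, (φ ⟨e, he⟩).2) = φ ⟨e, he⟩ := Prod.ext (Subtype.ext hex.symm) rfl
        simp only [this, Equiv.symm_apply_apply]
      · rintro ⟨i, rfl⟩
        refine ⟨(φ.symm (⟨x, hx⟩, i)).2, ?_⟩
        simp only [(φ.symm (⟨x, hx⟩, i)).2, dif_pos, Subtype.coe_eta, Equiv.apply_symm_apply]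
    · exact ⟨(φ ⟨e, he⟩).1.1, (φ ⟨e, he⟩).1.2, by simp [he]⟩

/-- The component of `v` is finite and all its vertices have even degree. -/
def InFiniteEvenComponent (G : SimpleGraph V) (v : V) : Prop :=
  {u | G.Reachable v u}.Finite ∧ ∀ u, G.Reachable v u → HasEvenDegree G u

theorem InFiniteEvenComponent.of_reachable {v x : V} (h : InFiniteEvenComponent G v)
    (hvx : G.Reachable v x) : InFiniteEvenComponent G x :=
  ⟨h.1.subset fun _ hu => hvx.trans hu, fun u hu => h.2 u (hvx.trans hu)⟩

/-- Three is the odd class size that serves both purposes: it rules out even closed subsystems, and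
balance up to one forces two colors into each class. -/
theorem exists_coloring_off_finite_even {C : Type w} [Nonempty C] (L : G.edgeSet → Finset C)
    (hL : ∀ e, (L e).card = 2) :
    ∃ c : G.edgeSet → C, (∀ e, c e ∈ L e) ∧ ∀ v, ¬ InFiniteEvenComponent G v →
      ((G.neighborSet v).Finite → ∀ γ, {e : G.edgeSet | v ∈ (e : Sym2 V) ∧ c e = γ}.ncard ≤
        {e : G.edgeSet | v ∈ (e : Sym2 V) ∧ c e ≠ γ}.ncard + 1) ∧
      (¬ (G.neighborSet v).Finite → IsMajorityColored c v) := by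
  classical
  choose t htfin htinf using exists_labeling (G := G)
  -- A vertex `v` of finite degree becomes the node `(v, none)`, one of infinite degree the nodes
  -- `(v, some x)` of degree 3. Vertices in finite even components receive no edges.
  let I : V × Option G.edgeSet → G.edgeSet → Prop := fun w e =>
    w.1 ∈ (e : Sym2 V) ∧ ¬ InFiniteEvenComponent G w.1 ∧ t w.1 e = w.2
  have hdegfin : ∀ v, ¬ InFiniteEvenComponent G v → (G.neighborSet v).Finite →
      {e | I (v, none) e} = {e : G.edgeSet | v ∈ (e : Sym2 V)} := fun v hv hvf => by
    ext e
    simp [I, hv, htfin v hvf]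
  have hdeginf : ∀ v l e, ¬ (G.neighborSet v).Finite → I (v, l) e →
      {e | I (v, l) e}.ncard = 3 := by
    rintro v l e hvf ⟨he, hv, hl⟩
    obtain ⟨x, hx, hxl⟩ := (htinf v hvf).2 e he
    obtain rfl : some x = l := hxl.symm.trans hl
    rw [← (htinf v hvf).1 x hx]
    congr 1
    ext e
    simp [I, hv]
  have hIsub : ∀ x y (h : G.Adj x y), {w | I w ⟨s(x, y), h⟩} ⊆
      {(x, t x ⟨s(x, y), h⟩), (y, t y ⟨s(x, y), h⟩)} := by
    rintro x y h ⟨v, l⟩ ⟨hv, -, hl⟩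
    dsimp only at hv hl
    subst hl
    rcases Sym2.mem_iff.mp hv with rfl | rfl
    · exact Or.inl rfl
    · exact Or.inr rfl
  obtain ⟨c, hcL, hc⟩ := exists_nearly_balanced (C := C) I (by
      rintro ⟨v, l⟩
      by_cases hvf : (G.neighborSet v).Finite
      · exact ((finite_incident_iff v).mpr hvf).subset fun e he => he.1
      · by_contra hinf
        obtain ⟨e, he⟩ := Set.Infinite.nonempty hinf
        have := hdeginf v l e hvf he
        rw [Set.Infinite.ncard hinf] at this
        omega) (by
      rintro ⟨e, h⟩
      induction e using Sym2.ind with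
      | _ x y =>
        refine ⟨(Set.toFinite _).subset (hIsub x y h), ?_⟩
        exact (Set.ncard_le_ncard (hIsub x y h) (Set.toFinite _)).trans (Set.ncard_insert_le _ _ |>.trans
          (by rw [Set.ncard_singleton]))) (by
      -- Even degrees exclude the nodes of degree 3, so `A` consists of unsplit vertices and is
      -- closed under adjacency; it contains a whole component, which is finite and even, a
      -- contradiction.
      intro A hA hne hAe heven hcl
      have hfinA : ∀ w ∈ A, (G.neighborSet w.1).Finite := fun w hw => by
        by_contra hinf
        obtain ⟨e, he⟩ := hAe w hw
        have := heven w hw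
        rw [hdeginf w.1 w.2 e hinf he] at this
        exact absurd this (by decide)
      have hnone : ∀ w ∈ A, ¬ InFiniteEvenComponent G w.1 ∧ w = (w.1, none) := fun w hw => by
        obtain ⟨e, he, hv, hl⟩ := hAe w hw
        rw [htfin _ (hfinA w hw)] at hl
        exact ⟨hv, Prod.ext rfl hl.symm⟩
      obtain ⟨w, hw⟩ := hne
      have hreach : ∀ u, G.Reachable w.1 u → (u, none) ∈ A := by
        rintro u ⟨q⟩
        have hwalk : ∀ {a b : V} (q : G.Walk a b), (a, none) ∈ A → (b, none) ∈ A := by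
          intro a b q
          induction q with
          | nil => exact id
          | @cons x y z hadj q ih =>
            intro hx
            refine ih ?_
            have hxI : I (x, none) ⟨s(x, y), hadj⟩ :=
              ⟨by simp, (hnone _ hx).1, htfin x (hfinA _ hx) _⟩
            obtain ⟨h2, hall⟩ := hcl _ hx _ hxI
            obtain ⟨w', hw', hne⟩ := Set.exists_ne_of_one_lt_ncard (by rw [h2]; omega) (x, none)
            have hw'A := hall w' hw'
            have hw'n := (hnone w' hw'A).2
            rw [hw'n] at hw'A hne hw'
            rcases Sym2.mem_iff.mp hw'.1 with h | h
            · dsimp only at h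
              rw [h] at hne
              exact absurd rfl hne
            · dsimp only at h
              rwa [h] at hw'A
        exact hwalk q ((hnone w hw).2 ▸ hw)
      refine (hnone w hw).1 ⟨(hA.image Prod.fst).subset fun u hu => ⟨_, hreach u hu, rfl⟩,
        fun u hu => ?_⟩
      have huA := hreach u hu
      refine ⟨hfinA _ huA, ?_⟩
      rw [← ncard_incident_eq_degree, ← hdegfin u (hnone _ huA).1 (hfinA _ huA)]
      exact heven _ huA) L hL
  refine ⟨c, hcL, fun v hv => ⟨fun hvf γ => ?_, fun hvf => ?_⟩⟩
  · have := hc (v, none) γ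
    simpa [I, hv, htfin v hvf] using this
  · rintro ⟨γ, hγ⟩
    refine hγ.not_ge ?_
    -- Each class has an edge of a color other than `γ`, since 3 ≤ 0 + 1 fails. As the classes are
    -- indexed by the edges at `v`, this injects all edges at `v` into those not of color `γ`.
    have hpick : ∀ x : {x : G.edgeSet // v ∈ (x : Sym2 V)}, ∃ e : G.edgeSet,
        (v ∈ (e : Sym2 V) ∧ c e ≠ γ) ∧ t v e = some x.1 := by
      rintro ⟨x, hx⟩
      by_contra! hcon
      have h1 := hc (v, some x) γ
      have h3 := (htinf v hvf).1 x hx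
      rw [show {e | I (v, some x) e ∧ c e ≠ γ} = ∅ by
          ext e
          simp only [Set.mem_ofPred_eq, Set.mem_empty_iff_false, iff_false]
          exact fun h => hcon e ⟨h.1.1, h.2⟩ h.1.2.2,
        show {e | I (v, some x) e ∧ c e = γ} =
            {e : G.edgeSet | v ∈ (e : Sym2 V) ∧ t v e = some x} by
          ext e
          refine ⟨fun h => ⟨h.1.1, h.1.2.2⟩, fun h => ⟨⟨h.1, hv, h.2⟩, ?_⟩⟩
          by_contra hne
          exact hcon e ⟨h.1, hne⟩ h.2, h3] at h1
      simp at h1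
    choose f hf hft using hpick
    calc incidentOfColor c v γ ≤ Cardinal.mk {x : G.edgeSet // v ∈ (x : Sym2 V)} :=
          Cardinal.mk_subtype_mono fun e he => he.1
      _ ≤ incidentOfOtherColor c v γ :=
          Cardinal.mk_le_of_injective (f := fun x => ⟨f x, hf x⟩) fun x y hxy => by
            have h1 := hft x
            rw [Subtype.mk.injEq] at hxy
            rw [hxy, hft y, Option.some_inj] at h1
            exact Subtype.ext h1.symm

end Graphs

/-! ### Majority coloring at vertices of finite degree -/

section Counting

variable {V : Type u} {G : SimpleGraph V} {C : Type w} {c : G.edgeSet → C} {v : V}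

theorem incidentOfColor_eq_ncard (hv : (G.neighborSet v).Finite) (γ : C) :
    incidentOfColor c v γ = {e : G.edgeSet | v ∈ (e : Sym2 V) ∧ c e = γ}.ncard :=
  (Set.cast_ncard (((finite_incident_iff v).mpr hv).subset fun _ h => h.1)).symm

theorem incidentOfOtherColor_eq_ncard (hv : (G.neighborSet v).Finite) (γ : C) :
    incidentOfOtherColor c v γ = {e : G.edgeSet | v ∈ (e : Sym2 V) ∧ c e ≠ γ}.ncard :=
  (Set.cast_ncard (((finite_incident_iff v).mpr hv).subset fun _ h => h.1)).symm

theorem isMajorityColored_iff (hv : (G.neighborSet v).Finite) :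
    IsMajorityColored c v ↔ ∀ γ, {e : G.edgeSet | v ∈ (e : Sym2 V) ∧ c e = γ}.ncard ≤
      {e : G.edgeSet | v ∈ (e : Sym2 V) ∧ c e ≠ γ}.ncard := by
  simp [IsMajorityColored, incidentOfColor_eq_ncard hv, incidentOfOtherColor_eq_ncard hv]

theorem ncard_color_add_ncard_other (hv : (G.neighborSet v).Finite) (γ : C) :
    {e : G.edgeSet | v ∈ (e : Sym2 V) ∧ c e = γ}.ncard +
      {e : G.edgeSet | v ∈ (e : Sym2 V) ∧ c e ≠ γ}.ncard = (G.neighborSet v).ncard := by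
  rw [← ncard_incident_eq_degree]
  exact Set.ncard_inter_add_ncard_sdiff_eq_ncard {e : G.edgeSet | v ∈ (e : Sym2 V)} {e | c e = γ}
    ((finite_incident_iff v).mpr hv)

theorem isMajorityColored_or_isAlmostMajorityColored (hv : (G.neighborSet v).Finite)
    (h : ∀ γ, {e : G.edgeSet | v ∈ (e : Sym2 V) ∧ c e = γ}.ncard ≤
      {e : G.edgeSet | v ∈ (e : Sym2 V) ∧ c e ≠ γ}.ncard + 1) :
    IsMajorityColored c v ∨ IsAlmostMajorityColored c v := by
  by_cases hmaj : IsMajorityColored c v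
  · exact Or.inl hmaj
  · refine Or.inr ⟨hmaj, ?_⟩
    obtain ⟨γ, hγ⟩ := not_not.mp hmaj
    refine ⟨γ, hγ, ?_⟩
    rw [incidentOfColor_eq_ncard hv, incidentOfOtherColor_eq_ncard hv]
    -- The excess is in fact at most one, within the two allowed.
    exact_mod_cast (h γ).trans (Nat.add_le_add_left one_le_two _)

/-- The excess of a color has the parity of the degree, so an even excess of at most one is at most
zero. -/
theorem isMajorityColored_of_even (hv : HasEvenDegree G v)
    (h : ∀ γ, {e : G.edgeSet | v ∈ (e : Sym2 V) ∧ c e = γ}.ncard ≤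
      {e : G.edgeSet | v ∈ (e : Sym2 V) ∧ c e ≠ γ}.ncard + 1) :
    IsMajorityColored c v := by
  rw [isMajorityColored_iff hv.1]
  intro γ
  have h1 := h γ
  have h2 := ncard_color_add_ncard_other (c := c) hv.1 γ
  obtain ⟨k, hk⟩ := hv.2
  omega

/-- With two colors, the edges not of color 1 are those of color 0, so the two majority inequalities
are opposite. -/
theorem degree_eq_of_isMajorityColored {c : G.edgeSet → Fin 2} (hv : (G.neighborSet v).Finite)
    (h : IsMajorityColored c v) :
    (G.neighborSet v).ncard = 2 * {e : G.edgeSet | v ∈ (e : Sym2 V) ∧ c e = 0}.ncard := by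
  rw [isMajorityColored_iff hv] at h
  have h0 := h 0
  have h1 := h 1
  have h2 := ncard_color_add_ncard_other (c := c) hv 0
  rw [show {e : G.edgeSet | v ∈ (e : Sym2 V) ∧ c e ≠ 1} =
      {e : G.edgeSet | v ∈ (e : Sym2 V) ∧ c e = 0} by
        ext e; exact and_congr_right fun _ => by generalize c e = i; revert i; decide,
    show {e : G.edgeSet | v ∈ (e : Sym2 V) ∧ c e = 1} =
      {e : G.edgeSet | v ∈ (e : Sym2 V) ∧ c e ≠ 0} by
        ext e; exact and_congr_right fun _ => by generalize c e = i; revert i; decide] at h1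
  omega

end Counting

/-! ### Passing between a graph and its components -/

section Components

variable {V : Type u} {G : SimpleGraph V} (K : G.ConnectedComponent)

theorem image_neighborSet_toSimpleGraph (v : K) :
    Subtype.val '' K.toSimpleGraph.neighborSet v = G.neighborSet (v : V) := by
  ext y
  constructor
  · rintro ⟨y, h, rfl⟩
    exact h
  · intro h
    exact ⟨⟨y, K.mem_supp_of_adj_mem_supp v.2 h⟩, h, rfl⟩

theorem ncard_neighborSet_toSimpleGraph (v : K) :
    (K.toSimpleGraph.neighborSet v).ncard = (G.neighborSet (v : V)).ncard := by
  rw [← image_neighborSet_toSimpleGraph, Set.ncard_image_of_injective _ Subtype.val_injective]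

theorem hasEvenDegree_toSimpleGraph_iff (v : K) :
    HasEvenDegree K.toSimpleGraph v ↔ HasEvenDegree G (v : V) := by
  rw [HasEvenDegree, HasEvenDegree, ncard_neighborSet_toSimpleGraph,
    ← image_neighborSet_toSimpleGraph, Set.finite_image_iff Subtype.val_injective.injOn]

theorem ncard_edgeSet_toSimpleGraph :
    K.toSimpleGraph.edgeSet.ncard = {e : Sym2 V | e ∈ G.edgeSet ∧ ∀ x ∈ e, x ∈ K}.ncard := by
  rw [← Set.ncard_image_of_injective _ (Sym2.map.injective (Subtype.val_injective (p := (· ∈ K))))]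
  congr 1
  ext e
  constructor
  · rintro ⟨e, he, rfl⟩
    induction e using Sym2.ind with
    | _ x y => exact ⟨he, by simp⟩
  · induction e using Sym2.ind with
    | _ x y =>
      rintro ⟨he, h⟩
      exact ⟨s(⟨x, h x (by simp)⟩, ⟨y, h y (by simp)⟩), he, rfl⟩

theorem mem_component_iff_reachable {r v : V} (hr : r ∈ K) : v ∈ K ↔ G.Reachable r v := by
  obtain rfl : G.connectedComponentMk r = K := hr
  exact ConnectedComponent.eq.trans reachable_comm

/-- In a two-colored majority edge-coloring every finite component has an even number of edges. -/
theorem not_isFiniteOfOddSize_of_isMajorityEdgeColoring {c : G.edgeSet → Fin 2}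
    (hc : IsMajorityEdgeColoring c) : ¬ IsFiniteOfOddSize K.toSimpleGraph := by
  classical
  rintro ⟨hfin, hodd⟩
  have := Fintype.ofFinite K
  let P : Sym2 V → Prop := fun e => ∃ h : e ∈ G.edgeSet, c ⟨e, h⟩ = 0
  -- The subgraph of color 0. Its degrees are half of those in `K`, so the number of edges of `K` is
  -- twice that of `H`.
  let H : SimpleGraph K :=
    { Adj := fun x y => P s((x : V), (y : V))
      symm := ⟨fun x y h => by rwa [Sym2.eq_swap]⟩
      loopless := ⟨fun x h => G.loopless.irrefl _ h.1⟩ }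
  have hdeg : ∀ v : K, K.toSimpleGraph.degree v = 2 * H.degree v := by
    intro v
    have hvfin : (G.neighborSet (v : V)).Finite := by
      rw [← image_neighborSet_toSimpleGraph]
      exact Set.toFinite _
    have h1 := degree_eq_of_isMajorityColored hvfin (hc v)
    rw [← ncard_neighborSet_toSimpleGraph] at h1
    have h2 := ncard_incident (G := G) (v : V) P
    have h3 : {y | G.Adj v y ∧ P s((v : V), y)} = Subtype.val '' H.neighborSet v := by
      ext y
      constructor
      · rintro ⟨h, hP⟩
        exact ⟨⟨y, K.mem_supp_of_adj_mem_supp v.2 h⟩, hP, rfl⟩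
      · rintro ⟨y, hP, rfl⟩
        exact ⟨hP.1, hP⟩
    rw [h3, Set.ncard_image_of_injective _ Subtype.val_injective] at h2
    have h4 : {e : G.edgeSet | (v : V) ∈ (e : Sym2 V) ∧ P e} =
        {e : G.edgeSet | (v : V) ∈ (e : Sym2 V) ∧ c e = 0} := by
      ext e
      simp [P]
    rw [← h4, h2, Set.ncard_eq_toFinset_card', Set.ncard_eq_toFinset_card', Set.toFinset_card,
      Set.toFinset_card, card_neighborSet_eq_degree, card_neighborSet_eq_degree] at h1
    exact h1
  have h1 := K.toSimpleGraph.sum_degrees_eq_twice_card_edges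
  rw [Finset.sum_congr rfl fun v _ => hdeg v, ← Finset.mul_sum,
    H.sum_degrees_eq_twice_card_edges] at h1
  rw [← coe_edgeFinset, Set.ncard_coe_finset] at hodd
  obtain ⟨k, hk⟩ := hodd
  omega

theorem isFiniteOfOddSize_toSimpleGraph_iff (hG : G.Preconnected) :
    IsFiniteOfOddSize K.toSimpleGraph ↔ IsFiniteOfOddSize G := by
  have hall : ∀ v, v ∈ K := fun v => by
    obtain ⟨r, hr⟩ := K.nonempty_supp
    exact (mem_component_iff_reachable K hr).mpr (hG r v)
  rw [IsFiniteOfOddSize, IsFiniteOfOddSize, ncard_edgeSet_toSimpleGraph]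
  refine and_congr ⟨fun h => ?_, fun h => Subtype.finite⟩ (by simp [hall])
  exact Finite.of_injective (fun v => (⟨v, hall v⟩ : K)) fun a b h => by simpa using h

end Components

/-! ### Gluing the colorings and the main theorem -/

theorem exists_isGoodEdgeColoring {V : Type u} {G : SimpleGraph V} {C : Type w}
    (hG : ∀ K : G.ConnectedComponent, ¬ (IsFiniteOfOddSize K.toSimpleGraph ∧
      ∀ v, HasEvenDegree K.toSimpleGraph v))
    (L : G.edgeSet → Finset C) (hL : ∀ e, (L e).card = 2) :
    ∃ c : G.edgeSet → C, (∀ e, c e ∈ L e) ∧ IsGoodEdgeColoring c := by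
  classical
  -- Without colors there are no edges, and no color can overwhelm a vertex.
  rcases isEmpty_or_nonempty C with hC | hC
  · have hE : ∀ e : G.edgeSet, False := fun e => by
      have := hL e
      rw [Finset.eq_empty_of_isEmpty (L e)] at this
      simp at this
    exact ⟨fun e => (hE e).elim, fun e => (hE e).elim,
      fun v _ ⟨γ, _⟩ => isEmptyElim γ, fun v _ => Or.inl fun ⟨γ, _⟩ => isEmptyElim γ⟩
  obtain ⟨c₁, hc₁L, hc₁⟩ := exists_coloring_off_finite_even L hL
  let L' : Sym2 V → Finset C := fun e => if h : e ∈ G.edgeSet then L ⟨e, h⟩ else ∅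
  have hL' : ∀ e ∈ G.edgeSet, (L' e).card = 2 := fun e he => by simp [L', he, hL, -mem_edgeSet]
  have heven : ∀ K : G.ConnectedComponent, ∃ c : Sym2 V → C, ∀ r ∈ K, InFiniteEvenComponent G r →
      (∀ e ∈ G.edgeSet, r ∈ e → c e ∈ L' e) ∧
      ∀ γ : C, {y | G.Adj r y ∧ c s(r, y) = γ}.ncard ≤ {y | G.Adj r y ∧ c s(r, y) ≠ γ}.ncard := by
    intro K
    by_cases hK : ∃ r ∈ K, InFiniteEvenComponent G r
    · obtain ⟨r, hr, hfin, hdeg⟩ := hK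
      have hmem : ∀ v, v ∈ K ↔ G.Reachable r v := fun v => mem_component_iff_reachable K hr
      obtain ⟨c, hcL, hc⟩ := exists_balanced_of_even_component r hfin hdeg (by
        have h := hG K
        simp only [not_and', hasEvenDegree_toSimpleGraph_iff] at h
        have h := h fun v => hdeg v ((hmem v).mp v.2)
        have hKfin : Finite K := by
          refine Set.Finite.to_subtype (s := {v | v ∈ K}) ?_
          simpa only [hmem] using hfin
        rw [IsFiniteOfOddSize, ncard_edgeSet_toSimpleGraph, not_and, Nat.not_odd_iff_even] at h
        simpa only [hmem] using h hKfin) L' hL'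
      refine ⟨c, fun v hv _ => ⟨fun e he hve => hcL e he fun x hx => ?_,
        hc v ((hmem v).mp hv)⟩⟩
      refine ((hmem v).mp hv).trans ?_
      by_cases hxv : v = x
      · rw [hxv]
      · rw [(Sym2.mem_and_mem_iff hxv).mp ⟨hve, hx⟩] at he
        exact Adj.reachable he
    · exact ⟨fun _ => Classical.arbitrary C, fun r hr h => absurd ⟨r, hr, h⟩ hK⟩
  choose c₂ hc₂ using heven
  -- Both ends of an edge lie in one component, so the chosen end does not matter and all edges at a
  -- vertex follow the same one of the two colorings.
  let c : G.edgeSet → C := fun e =>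
    if h : ∃ v ∈ (e : Sym2 V), InFiniteEvenComponent G v
    then c₂ (G.connectedComponentMk h.choose) e else c₁ e
  have hreach : ∀ (e : G.edgeSet) (x y : V), x ∈ (e : Sym2 V) → y ∈ (e : Sym2 V) →
      G.Reachable x y := by
    intro e x y hx hy
    by_cases hxy : x = y
    · rw [hxy]
    · have := e.2
      rw [(Sym2.mem_and_mem_iff hxy).mp ⟨hx, hy⟩] at this
      exact Adj.reachable this
  have hcin : ∀ v, InFiniteEvenComponent G v → ∀ e : G.edgeSet, v ∈ (e : Sym2 V) →
      c e = c₂ (G.connectedComponentMk v) e := by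
    intro v hv e he
    have h : ∃ v ∈ (e : Sym2 V), InFiniteEvenComponent G v := ⟨v, he, hv⟩
    simp only [c, dif_pos h]
    rw [ConnectedComponent.eq.mpr (hreach e _ _ h.choose_spec.1 he)]
  have hcout : ∀ v, ¬ InFiniteEvenComponent G v → ∀ e : G.edgeSet, v ∈ (e : Sym2 V) →
      c e = c₁ e := by
    intro v hv e he
    exact dif_neg fun ⟨x, hx, hxe⟩ => hv (hxe.of_reachable (hreach e _ _ hx he))
  have hin : ∀ v, InFiniteEvenComponent G v → IsMajorityColored c v := by
    intro v hv
    rw [isMajorityColored_iff (hv.2 v (Reachable.refl v)).1]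
    intro γ
    have := (hc₂ (G.connectedComponentMk v) v rfl hv).2 γ
    rw [← ncard_incident v fun e => c₂ (G.connectedComponentMk v) e = γ,
      ← ncard_incident v fun e => c₂ (G.connectedComponentMk v) e ≠ γ] at this
    convert this using 2
    · ext e; exact and_congr_right fun he => by rw [hcin v hv e he]
    · ext e; exact and_congr_right fun he => by rw [hcin v hv e he]
  have hout : ∀ v, ¬ InFiniteEvenComponent G v → (G.neighborSet v).Finite → ∀ γ,
      {e : G.edgeSet | v ∈ (e : Sym2 V) ∧ c e = γ}.ncard ≤
        {e : G.edgeSet | v ∈ (e : Sym2 V) ∧ c e ≠ γ}.ncard + 1 := by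
    intro v hv hvf γ
    convert (hc₁ v hv).1 hvf γ using 3
    · ext e; exact and_congr_right fun he => by rw [hcout v hv e he]
    · congr 1; ext e; exact and_congr_right fun he => by rw [hcout v hv e he]
  refine ⟨c, fun e => ?_, fun v hodd => ?_, fun v hodd => ?_⟩
  · by_cases h : ∃ v ∈ (e : Sym2 V), InFiniteEvenComponent G v
    · obtain ⟨v, hve, hv⟩ := h
      rw [hcin v hv e hve]
      have := (hc₂ (G.connectedComponentMk v) v rfl hv).1 e e.2 hve
      simpa [L', -mem_edgeSet] using this
    · simp only [c, dif_neg h]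
      exact hc₁L e
  · by_cases hv : InFiniteEvenComponent G v
    · exact hin v hv
    · by_cases hvf : (G.neighborSet v).Finite
      · exact isMajorityColored_of_even
          ⟨hvf, Nat.not_odd_iff_even.mp fun h => hodd ⟨hvf, h⟩⟩ (hout v hv hvf)
      · rintro ⟨γ, hγ⟩
        refine (hc₁ v hv).2 hvf ⟨γ, ?_⟩
        convert hγ using 1
        · unfold incidentOfOtherColor
          congr! 3 with e
          exact and_congr_right fun he => by rw [hcout v hv e he]
        · unfold incidentOfColor
          congr! 3 with e
          exact and_congr_right fun he => by rw [hcout v hv e he]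
  · by_cases hv : InFiniteEvenComponent G v
    · exact Or.inl (hin v hv)
    · exact isMajorityColored_or_isAlmostMajorityColored hodd.1 (hout v hv hodd.1)

/-- Two-coloring is the case of constant lists; `ULift` moves the two colors to the universe of the
lists. -/
theorem HasMajorityListEdgeColorings.hasMajorityEdgeColoring {V : Type u} {G : SimpleGraph V}
    (h : HasMajorityListEdgeColorings.{u, w} G 2) : HasMajorityEdgeColoring G 2 := by
  obtain ⟨c, -, hc⟩ := h (ULift.{w} (Fin 2)) (fun _ => Finset.univ) (fun _ => by simp)
  refine ⟨fun e => (c e).down, fun v hv => hc v ?_⟩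
  obtain ⟨α, hα⟩ := hv
  refine ⟨ULift.up α, ?_⟩
  simpa only [incidentOfColor, incidentOfOtherColor, ne_eq, ULift.ext_iff] using hα

theorem HasMajorityEdgeColoring.components {V : Type u} {G : SimpleGraph V}
    (h : HasMajorityEdgeColoring G 2) : (∀ v, ¬ HasOddDegree G v) ∧
      ∀ K : G.ConnectedComponent, ¬ IsFiniteOfOddSize K.toSimpleGraph := by
  obtain ⟨c, hc⟩ := h
  refine ⟨fun v hv => ?_, fun K => not_isFiniteOfOddSize_of_isMajorityEdgeColoring K hc⟩
  have h1 := degree_eq_of_isMajorityColored hv.1 (hc v)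
  obtain ⟨k, hk⟩ := hv.2
  omega

theorem hasMajorityListEdgeColorings_of_components {V : Type u} {G : SimpleGraph V}
    (h : (∀ v, ¬ HasOddDegree G v) ∧
      ∀ K : G.ConnectedComponent, ¬ IsFiniteOfOddSize K.toSimpleGraph) :
    HasMajorityListEdgeColorings.{u, w} G 2 := by
  intro C L hL
  obtain ⟨c, hcL, hc⟩ := exists_isGoodEdgeColoring (fun K hK => h.2 K hK.1) L hL
  exact ⟨c, hcL, fun v => hc.1 v (h.1 v)⟩

end MajorityEdgeColoring

open MajorityEdgeColoring in
theorem mainTheorem1 {V : Type u} (G : SimpleGraph V) :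
    -- connected graphs
    (G.Preconnected →
      (HasMajorityListEdgeColorings.{u, w} G 2 ↔
        (∀ v, ¬ HasOddDegree G v) ∧ ¬ IsFiniteOfOddSize G) ∧
      (∀ (C : Type w) (L : G.edgeSet → Finset C), (∀ e, (L e).card = 2) →
        (∃ c : G.edgeSet → C, (∀ e, c e ∈ L e) ∧ IsGoodEdgeColoring c) ∨
          (IsFiniteOfOddSize G ∧ ∀ v, HasEvenDegree G v)) ∧
      (HasMajorityEdgeColoring G 2 ↔
        (∀ v, ¬ HasOddDegree G v) ∧ ¬ IsFiniteOfOddSize G)) ∧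
    -- arbitrary graphs
    (HasMajorityListEdgeColorings.{u, w} G 2 ↔
      (∀ v, ¬ HasOddDegree G v) ∧
        ∀ K : G.ConnectedComponent, ¬ IsFiniteOfOddSize K.toSimpleGraph) ∧
    (∀ (C : Type w) (L : G.edgeSet → Finset C), (∀ e, (L e).card = 2) →
      (∃ c : G.edgeSet → C, (∀ e, c e ∈ L e) ∧ IsGoodEdgeColoring c) ∨
        ∃ K : G.ConnectedComponent, IsFiniteOfOddSize K.toSimpleGraph ∧
          ∀ v, HasEvenDegree K.toSimpleGraph v) ∧
    (HasMajorityEdgeColoring G 2 ↔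
      (∀ v, ¬ HasOddDegree G v) ∧
        ∀ K : G.ConnectedComponent, ¬ IsFiniteOfOddSize K.toSimpleGraph) := by
  have h1 : HasMajorityListEdgeColorings.{u, w} G 2 ↔ (∀ v, ¬ HasOddDegree G v) ∧
      ∀ K : G.ConnectedComponent, ¬ IsFiniteOfOddSize K.toSimpleGraph :=
    ⟨fun h => h.hasMajorityEdgeColoring.components, hasMajorityListEdgeColorings_of_components⟩
  have h3 : HasMajorityEdgeColoring G 2 ↔ (∀ v, ¬ HasOddDegree G v) ∧
      ∀ K : G.ConnectedComponent, ¬ IsFiniteOfOddSize K.toSimpleGraph :=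
    ⟨fun h => h.components, fun h => (h1.mpr h).hasMajorityEdgeColoring⟩
  have h2 : ∀ (C : Type w) (L : G.edgeSet → Finset C), (∀ e, (L e).card = 2) →
      (∃ c : G.edgeSet → C, (∀ e, c e ∈ L e) ∧ IsGoodEdgeColoring c) ∨
        ∃ K : G.ConnectedComponent, IsFiniteOfOddSize K.toSimpleGraph ∧
          ∀ v, HasEvenDegree K.toSimpleGraph v := by
    intro C L hL
    by_cases h : ∃ K : G.ConnectedComponent, IsFiniteOfOddSize K.toSimpleGraph ∧
        ∀ v, HasEvenDegree K.toSimpleGraph v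
    · exact Or.inr h
    · exact Or.inl (exists_isGoodEdgeColoring (not_exists.mp h) L hL)
  refine ⟨fun hG => ?_, h1, h2, h3⟩
  have hsize : (∀ K : G.ConnectedComponent, ¬ IsFiniteOfOddSize K.toSimpleGraph) ↔
      ¬ IsFiniteOfOddSize G := by
    constructor
    · intro h hfin
      -- `G.Preconnected` admits the empty graph, which has no component; its size 0 is not odd.
      rcases isEmpty_or_nonempty V with hV | ⟨⟨v⟩⟩
      · have := hfin.2
        simp [Set.eq_empty_of_isEmpty] at this
      · exact h (G.connectedComponentMk v) ((isFiniteOfOddSize_toSimpleGraph_iff _ hG).mpr hfin)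
    · exact fun h K hK => h ((isFiniteOfOddSize_toSimpleGraph_iff K hG).mp hK)
  rw [← hsize]
  refine ⟨h1, fun C L hL => (h2 C L hL).imp_right ?_, h3⟩
  rintro ⟨K, hK, heven⟩
  refine ⟨(isFiniteOfOddSize_toSimpleGraph_iff K hG).mp hK, fun v => ?_⟩
  obtain ⟨r, hr⟩ := K.nonempty_supp
  exact (hasEvenDegree_toSimpleGraph_iff K ⟨v, (mem_component_iff_reachable K hr).mpr (hG r v)⟩).mp
    (heven _)
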